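/- Let $H$ be a complex Hilbert space and $B(H)$ the algebra of bounded linear operators on $H$. Write $B(H)_{++}$ for the set of positive invertible elements of $B(H)$, $|T|=(T^*T)^{1/2}$, and $\mathrm{Tr}$ for the usual $[0,\infty]$-valued trace of positive operators. For $r>0$ let $\mathcal S_r=\{T\in B(H):\mathrm{Tr}|T|^r<\infty\}$. A UCPTP map over $B(H)$ is a completely positive linear map $\phi:B(H)\to B(H)$ that is unital ($\phi(\mathbf 1)=\mathbf 1$) and trace preserving ($\mathrm{Tr}\,\phi(X)=\mathrm{Tr}\,X$ for all positive $X\in B(H)$). Let $0<p,q\le 1/2$ with $p+q\le 1/2$, and let $2\le s\le 1/(p+q)$. Then $$\mathrm{Tr}\,\bigl|\phi(B)^{-p}\phi(A)\phi(C)^{-q}\bigr|^s\;\le\;\mathrm{Tr}\,\bigl|B^{-p}AC^{-q}\bigr|^s$$ for any $A\in B(H)$, any $B,C\in B(H)_{++}$ such that $B^{-ps},C^{-qs}\in\mathcal S_{1/2}$, and any UCPTP map $\phi$ over $B(H)$ such that $\phi(B)^{-ps},\phi(C)^{-qs}\in\mathcal S_{1/2}$. -/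

import Mathlib

open scoped ENNReal CStarAlgebra InnerProductSpace

/-- The usual trace of a positive bounded operator `T` on a complex Hilbert space, with values in
`[0, ∞]`: the sum of `⟪e, T e⟫` over an orthonormal basis. It does not depend on the basis, see
`opTrace_eq_tsum`. It is only meant for (and only applied to) positive operators. -/
noncomputable def opTrace {H : Type*} [NormedAddCommGroup H] [InnerProductSpace ℂ H]
    [CompleteSpace H] (T : H →L[ℂ] H) : ℝ≥0∞ :=
  ∑' e : (exists_hilbertBasis ℂ H).choose, ENNReal.ofReal (RCLike.re ⟪(e : H), T e⟫_ℂ)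

theorem tsum_norm_sq_inner_hilbertBasis {H : Type*} [NormedAddCommGroup H]
    [InnerProductSpace ℂ H] {ι : Type*} (b : HilbertBasis ι ℂ H) (x : H) :
    ∑' i, ENNReal.ofReal (‖⟪b i, x⟫_ℂ‖ ^ 2) = ENNReal.ofReal (‖x‖ ^ 2) := by
  have h := b.hasSum_inner_mul_inner x x
  have h2 : HasSum (fun i => ‖⟪b i, x⟫_ℂ‖ ^ 2) (‖x‖ ^ 2) := by
    have h3 := Complex.hasSum_re h
    convert h3 using 1
    · funext i
      rw [← inner_conj_symm x (b i), RCLike.conj_mul]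
      norm_cast
    · rw [inner_self_eq_norm_sq_to_K]
      norm_cast
  rw [← h2.tsum_eq, ENNReal.ofReal_tsum_of_nonneg (fun i => by positivity) h2.summable]

theorem tsum_ofReal_inner_hilbertBasis_comm {H : Type*} [NormedAddCommGroup H]
    [InnerProductSpace ℂ H] [CompleteSpace H] {ι κ : Type*} (b : HilbertBasis ι ℂ H)
    (c : HilbertBasis κ ℂ H) {T : H →L[ℂ] H} (hT : 0 ≤ T) :
    ∑' i, ENNReal.ofReal (RCLike.re ⟪b i, T (b i)⟫_ℂ) =
      ∑' j, ENNReal.ofReal (RCLike.re ⟪c j, T (c j)⟫_ℂ) := by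
  have hsq : CFC.sqrt T * CFC.sqrt T = T := CFC.sqrt_mul_sqrt_self T hT
  have hsa : IsSelfAdjoint (CFC.sqrt T) := (CFC.sqrt_nonneg T).isSelfAdjoint
  have hsymm : ∀ x y : H, ⟪CFC.sqrt T x, y⟫_ℂ = ⟪x, CFC.sqrt T y⟫_ℂ := fun x y =>
    hsa.isSymmetric x y
  have key : ∀ x : H, RCLike.re ⟪x, T x⟫_ℂ = ‖CFC.sqrt T x‖ ^ 2 := fun x => by
    conv_lhs => rw [← hsq]
    rw [mul_apply_eq_comp, ← hsymm]
    exact (norm_sq_eq_re_inner (𝕜 := ℂ) _).symm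
  simp only [key]
  calc ∑' i, ENNReal.ofReal (‖CFC.sqrt T (b i)‖ ^ 2)
      = ∑' i, ∑' j, ENNReal.ofReal (‖⟪c j, CFC.sqrt T (b i)⟫_ℂ‖ ^ 2) := by
        simp only [tsum_norm_sq_inner_hilbertBasis]
    _ = ∑' j, ∑' i, ENNReal.ofReal (‖⟪c j, CFC.sqrt T (b i)⟫_ℂ‖ ^ 2) := ENNReal.tsum_comm
    _ = ∑' j, ∑' i, ENNReal.ofReal (‖⟪b i, CFC.sqrt T (c j)⟫_ℂ‖ ^ 2) := by
        congr! 5 with j i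
        rw [← hsymm, norm_inner_symm]
    _ = ∑' j, ENNReal.ofReal (‖CFC.sqrt T (c j)‖ ^ 2) := by
        simp only [tsum_norm_sq_inner_hilbertBasis]

/-- The trace of a positive operator may be computed in any orthonormal basis. -/
theorem opTrace_eq_tsum {H : Type*} [NormedAddCommGroup H] [InnerProductSpace ℂ H]
    [CompleteSpace H] {ι : Type*} (b : HilbertBasis ι ℂ H) {T : H →L[ℂ] H} (hT : 0 ≤ T) :
    opTrace T = ∑' i, ENNReal.ofReal (RCLike.re ⟪b i, T (b i)⟫_ℂ) := by
  obtain ⟨c, hc⟩ := (exists_hilbertBasis ℂ H).choose_spec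
  rw [tsum_ofReal_inner_hilbertBasis_comm b c hT, hc, opTrace]

/-- `Tr |T| ^ r`, where `|T| = (T* T) ^ (1/2)`, for a real exponent `r > 0`. -/
noncomputable def traceAbsPow {H : Type*} [NormedAddCommGroup H] [InnerProductSpace ℂ H]
    [CompleteSpace H] (T : H →L[ℂ] H) (r : ℝ) : ℝ≥0∞ :=
  opTrace (CFC.abs T ^ r)

/-- The bounded operator `T` belongs to the Schatten class `S_r` (`0 < r < ∞`). -/
def MemSchatten {H : Type*} [NormedAddCommGroup H] [InnerProductSpace ℂ H]
    [CompleteSpace H] (r : ℝ) (T : H →L[ℂ] H) : Prop :=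
  traceAbsPow T r < ∞

/-- A completely positive map on `B(H)` is UCPTP if it is unital and trace preserving, i.e. it
preserves the `[0, ∞]`-valued trace of positive operators. -/
structure IsUCPTP {H : Type*} [NormedAddCommGroup H] [InnerProductSpace ℂ H]
    [CompleteSpace H] (φ : (H →L[ℂ] H) →CP (H →L[ℂ] H)) : Prop where
  unital : φ 1 = 1
  trace_preserving : ∀ X : H →L[ℂ] H, 0 ≤ X → opTrace (φ X) = opTrace X

/-!
The integrability hypotheses force `H` to be finite-dimensional: `B` is bounded, so a negative power
of `B` is bounded below by a positive multiple of the identity, and it can have a finite Schatten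
quasi-norm only if the index set of an orthonormal basis is finite
(`finiteDimensional_of_memSchatten`). From then on the trace is an everywhere defined positive
tracial functional `τ` with `τ ∘ φ = τ`, and powers of operators are entire in the exponent.

The theorem says that the map `T_{a,b} : X ↦ φ(B)^{-a} φ(B^a X C^b) φ(C)^{-b}` is a contraction of the
Schatten class `S_s` for `(a, b) = (p, q)`, tested at `X = B^{-p} A C^{-q}`. It follows from an
operator Schwarz inequality by two rounds of complex interpolation.

* Unital completely positive maps satisfy `φ(A)* φ(B)⁻¹ φ(A) ≤ φ(A* B⁻¹ A)`, by positivity of `φ` on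
  two by two matrices (`CompletelyPositiveMap.star_mul_inv_mul_le`). With trace preservation this
  makes `T_{a,b}` a Hilbert-Schmidt contraction at the vertices `(0,0)`, `(1/2,0)`, `(0,1/2)`. The
  same inequality shows that `φ = T_{0,0}` is a contraction in the operator norm.
* For complex exponents, the imaginary parts of `a` and `b` only contribute unitary factors
  (`twistedMap_eq_re_im`), so the three lines theorem applies to `z ↦ T_{a(z), b(z)}` with `a`, `b`
  affine (`norm_twistedMap_three_lines`). Hence the set of `(a, b)` for which `T_{a,b}` is a
  Hilbert-Schmidt contraction is convex, and it contains the triangle `a, b > 0`, `a + b ≤ 1/2`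
  (`hsSq_twistedMap_le`).
* Stein interpolation between the Hilbert-Schmidt bound at `(ps/2, qs/2)`, which is in that triangle
  because `s (p + q) ≤ 1`, and the operator norm bound at `(0, 0)` gives the bound for `S_s` at
  `(p, q)` (`trace_abs_rpow_le`). The holomorphic families of operators needed here come from a polar
  decomposition in exponential form (`exists_polar_exp`).
-/

-- Some lemmas on the functional `τ` use fewer of the standing order assumptions than others.
set_option linter.unusedSectionVars false

/-! ### The Schwarz inequality for unital completely positive maps -/

section CP
variable {𝒜 : Type*} [CStarAlgebra 𝒜] [PartialOrder 𝒜] [StarOrderedRing 𝒜]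

theorem CStarMatrix.diag_nonneg {n : Type*} [Fintype n] {M : CStarMatrix n n 𝒜} (hM : 0 ≤ M)
    (i : n) : 0 ≤ M i i := by
  rw [StarOrderedRing.nonneg_iff] at hM
  induction hM using AddSubmonoid.closure_induction with
  | mem M hM =>
    obtain ⟨N, rfl⟩ := hM
    change 0 ≤ (star N * N) i i
    rw [CStarMatrix.mul_apply]
    exact Finset.sum_nonneg fun j _ => by
      rw [CStarMatrix.star_apply]; exact star_mul_self_nonneg _
  | zero => rfl
  | add M N _ _ h₁ h₂ => exact add_nonneg h₁ h₂

theorem IsStrictlyPositive.map_cp (φ : 𝒜 →CP 𝒜) (hφ : φ 1 = 1) {B : 𝒜}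
    (hB : IsStrictlyPositive B) : IsStrictlyPositive (φ B) := by
  rcases subsingleton_or_nontrivial 𝒜 with h𝒜 | h𝒜
  · exact IsStrictlyPositive.of_subsingleton
  obtain ⟨r, hr, h⟩ := (CFC.exists_pos_algebraMap_le_iff hB.isSelfAdjoint).2
    fun x hx => hB.spectrum_pos hx
  refine IsStrictlyPositive.of_le (a := algebraMap ℝ 𝒜 r)
    (by
      rw [Algebra.algebraMap_eq_smul_one]
      exact isStrictlyPositive_one.smul hr) ?_
  have h2 : φ (algebraMap ℝ 𝒜 r) ≤ φ B := OrderHomClass.mono φ h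
  rwa [Algebra.algebraMap_eq_smul_one, ← Complex.coe_smul, map_smul, hφ, Complex.coe_smul,
    ← Algebra.algebraMap_eq_smul_one] at h2

/-- The operator Schwarz inequality of Lieb and Ruskai: the matrix with rows `B, A` and
`A*, A* B⁻¹ A` is positive, hence so is its image under `φ`, and the inequality is nonnegativity of
the Schur complement of `φ B` in this image. -/
theorem CompletelyPositiveMap.star_mul_inv_mul_le (φ : 𝒜 →CP 𝒜) (hφ : φ 1 = 1) {B : 𝒜}
    (hB : IsStrictlyPositive B) (A : 𝒜) :
    star (φ A) * φ B ^ (-1 : ℝ) * φ A ≤ φ (star A * B ^ (-1 : ℝ) * A) := by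
  have hφB := hB.map_cp φ hφ
  have hφi : star (φ B ^ (-1 : ℝ)) = φ B ^ (-1 : ℝ) := CFC.rpow_nonneg.isSelfAdjoint
  set D := B ^ (-1 : ℝ) with hD
  set E := φ B ^ (-1 : ℝ) with hE
  set S := B ^ (1 / 2 : ℝ) with hS
  set R := B ^ (-(1 / 2) : ℝ) with hR
  have hSs : star S = S := CFC.rpow_nonneg.isSelfAdjoint
  have hRs : star R = R := CFC.rpow_nonneg.isSelfAdjoint
  have hSS : S * S = B := by
    rw [hS, ← CFC.rpow_add hB.isUnit]; norm_num; exact CFC.rpow_one B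
  have hSR : S * R = 1 := CFC.rpow_mul_rpow_neg _
  have hRS : R * S = 1 := CFC.rpow_neg_mul_rpow _
  have hRR : R * R = D := by
    rw [hR, ← CFC.rpow_add hB.isUnit]; norm_num; rfl
  -- `star N * N` has rows `B, A` and `star A, star A * B⁻¹ * A`.
  let N : CStarMatrix (Fin 2) (Fin 2) 𝒜 := CStarMatrix.ofMatrix !![S, R * A; 0, 0]
  have h1 := φ.map_cstarMatrix_nonneg (star N * N) (star_mul_self_nonneg N)
  -- Conjugation by `V` produces the Schur complement in the lower right corner.
  let V : CStarMatrix (Fin 2) (Fin 2) 𝒜 := CStarMatrix.ofMatrix !![0, - (E * φ A); 0, 1]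
  have h2 := CStarMatrix.diag_nonneg (star_left_conjugate_nonneg h1 V) 1
  have h00 : (star N * N) 0 0 = B := by
    simp [CStarMatrix.mul_apply, CStarMatrix.star_apply, N, hSs, hSS]
  have h01 : (star N * N) 0 1 = A := by
    simp [CStarMatrix.mul_apply, CStarMatrix.star_apply, N, hSs, ← mul_assoc, hSR]
  have h10 : (star N * N) 1 0 = star A := by
    simp [CStarMatrix.mul_apply, CStarMatrix.star_apply, N, hRs, mul_assoc, hRS]
  have h11 : (star N * N) 1 1 = star A * D * A := by
    simp [CStarMatrix.mul_apply, CStarMatrix.star_apply, N, hRs]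
    rw [← hRR]; noncomm_ring
  rw [← sub_nonneg]
  convert h2 using 1
  rw [CStarMatrix.mul_apply]
  simp only [Fin.sum_univ_two, CStarMatrix.mul_apply (M := star V), CStarMatrix.star_apply,
    CStarMatrix.map_apply, h00, h01, h10, h11]
  have hst : φ (star A) = star (φ A) := map_star φ A
  simp [V, hst, hφi, mul_assoc]
  have hEB : E * φ B = 1 := by
    have := CFC.rpow_neg_mul_rpow (a := φ B) 1
    rwa [CFC.rpow_one (φ B)] at this
  simp [hEB]
  abel

/-- Kadison's inequality, the case `B = 1` of `star_mul_inv_mul_le`. -/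
theorem CompletelyPositiveMap.star_mul_le (φ : 𝒜 →CP 𝒜) (hφ : φ 1 = 1) (A : 𝒜) :
    star (φ A) * φ A ≤ φ (star A * A) := by
  simpa [hφ] using φ.star_mul_inv_mul_le hφ isStrictlyPositive_one A

theorem CompletelyPositiveMap.norm_map_le (φ : 𝒜 →CP 𝒜) (hφ : φ 1 = 1) (A : 𝒜) :
    ‖φ A‖ ≤ ‖A‖ := by
  have h1 : φ (star A * A) ≤ algebraMap ℝ 𝒜 (‖A‖ ^ 2) := by
    have h2 : φ (star A * A) ≤ φ (algebraMap ℝ 𝒜 (‖A‖ ^ 2)) :=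
      OrderHomClass.mono φ CStarAlgebra.star_mul_le_algebraMap_norm_sq
    rwa [Algebra.algebraMap_eq_smul_one, ← Complex.coe_smul, map_smul, hφ, Complex.coe_smul,
      ← Algebra.algebraMap_eq_smul_one] at h2
  have h3 := (CStarAlgebra.norm_le_iff_le_algebraMap _ (by positivity)
    (star_mul_self_nonneg _)).2 ((φ.star_mul_le hφ A).trans h1)
  rw [CStarRing.norm_star_mul_self, ← sq] at h3
  exact le_of_sq_le_sq h3 (norm_nonneg _)

end CP

/-! ### Complex powers as exponentials -/

section ExpPowers
open NormedSpace
variable {𝒜 : Type*} [CStarAlgebra 𝒜]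

theorem exp_add_smul (L : 𝒜) (z w : ℂ) : exp ((z + w) • L) = exp (z • L) * exp (w • L) := by
  let _ : NormedAlgebra ℚ 𝒜 := .restrictScalars ℚ ℂ 𝒜
  rw [add_smul]
  exact exp_add_of_commute ((Commute.refl L).smul_left z |>.smul_right w)

theorem exp_neg_smul_mul (L : 𝒜) (z : ℂ) : exp (-z • L) * exp (z • L) = 1 := by
  rw [← exp_add_smul]; simp

theorem exp_smul_mul_neg (L : 𝒜) (z : ℂ) : exp (z • L) * exp (-z • L) = 1 := by
  rw [← exp_add_smul]; simp

theorem star_exp_smul {L : 𝒜} (hL : IsSelfAdjoint L) (z : ℂ) :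
    star (exp (z • L)) = exp (star z • L) := by
  rw [NormedSpace.star_exp, star_smul, hL.star_eq]

theorem exp_smul_I_mem_unitary {L : 𝒜} (hL : IsSelfAdjoint L) (y : ℝ) :
    exp ((y * Complex.I : ℂ) • L) ∈ unitary 𝒜 := by
  have h : star (y * Complex.I : ℂ) = -(y * Complex.I) := by simp
  rw [Unitary.mem_iff, star_exp_smul hL, h]
  exact ⟨exp_neg_smul_mul _ _, exp_smul_mul_neg _ _⟩

theorem exp_smul_re_im (L : 𝒜) (z : ℂ) :
    exp (z • L) = exp ((z.re : ℂ) • L) * exp ((z.im * Complex.I : ℂ) • L) := by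
  rw [← exp_add_smul, Complex.re_add_im]

theorem exp_smul_im_re (L : 𝒜) (z : ℂ) :
    exp (z • L) = exp ((z.im * Complex.I : ℂ) • L) * exp ((z.re : ℂ) • L) := by
  rw [← exp_add_smul, add_comm, Complex.re_add_im]

theorem differentiable_exp_smul (L : 𝒜) : Differentiable ℂ fun z : ℂ => exp (z • L) :=
  fun z => (hasDerivAt_exp_smul_const L z).differentiableAt

theorem norm_exp_smul_eq {L : 𝒜} (hL : IsSelfAdjoint L) (z : ℂ) :
    ‖exp (z • L)‖ = ‖exp ((z.re : ℂ) • L)‖ := by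
  rw [exp_smul_re_im, CStarRing.norm_mul_mem_unitary _ (exp_smul_I_mem_unitary hL _)]

theorem exists_norm_exp_smul_le {L : 𝒜} (hL : IsSelfAdjoint L) (α β : ℝ) :
    ∃ C, ∀ z : ℂ, z.re ∈ Set.Icc (0 : ℝ) 1 → ‖exp ((α + β * z : ℂ) • L)‖ ≤ C := by
  have hc : Continuous fun x : ℝ => exp (((α + β * x : ℝ) : ℂ) • L) :=
    (differentiable_exp_smul L).continuous.comp (by fun_prop)
  obtain ⟨C, hC⟩ := isCompact_Icc.exists_bound_of_continuousOn (s := Set.Icc (0 : ℝ) 1)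
    hc.continuousOn
  refine ⟨C, fun z hz => ?_⟩
  rw [norm_exp_smul_eq hL]
  simpa using hC _ hz

/-- Exponentials of a functional calculus; with `f = Real.log` these are powers of `a`, up to the
value at the eigenvalue `0`. -/
theorem CFC.cfc_exp_smul {f : ℝ → ℝ} {a : 𝒜} (ha : IsSelfAdjoint a)
    (hf : ContinuousOn f (spectrum ℝ a)) (x : ℝ) :
    exp ((x : ℂ) • cfc f a) = cfc (fun t => Real.exp (x * f t)) a := by
  rw [Complex.coe_smul, ← cfc_smul x f a, ← CFC.real_exp_eq_normedSpace_exp (cfc_predicate _ _),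
    ← cfc_comp' Real.exp (fun t => x • f t) a]
  rfl

variable [PartialOrder 𝒜] [StarOrderedRing 𝒜]

theorem IsStrictlyPositive.rpow_eq_exp {B : 𝒜} (hB : IsStrictlyPositive B) (x : ℝ) :
    B ^ x = exp ((x : ℂ) • CFC.log B) := by
  have h0 : ∀ t ∈ spectrum ℝ B, 0 < t := fun t ht => hB.spectrum_pos ht
  rw [CFC.log, CFC.cfc_exp_smul hB.isSelfAdjoint
    (ContinuousOn.mono Real.continuousOn_log fun t ht => (h0 t ht).ne'), CFC.rpow_eq_cfc_real hB.nonneg]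
  refine cfc_congr fun t ht => ?_
  rw [Real.rpow_def_of_pos (h0 t ht), mul_comm]

end ExpPowers


/-! ### The Hilbert-Schmidt seminorm of a tracial functional -/

section Trace
open scoped ComplexOrder
variable {𝒜 : Type*} [CStarAlgebra 𝒜] [PartialOrder 𝒜] [StarOrderedRing 𝒜] (τ : 𝒜 →ₚ[ℂ] ℂ)

/-- The squared Hilbert-Schmidt (semi)norm `τ (a* a)` of `a` with respect to a positive functional
`τ`. The value of `τ` is real, so taking the real part loses nothing, see `coe_hsSq`. -/
noncomputable def hsSq (a : 𝒜) : ℝ := (τ (star a * a)).re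

theorem hsSq_nonneg (a : 𝒜) : 0 ≤ hsSq τ a :=
  (Complex.le_def.1 (map_nonneg τ (star_mul_self_nonneg a))).1

theorem coe_hsSq (a : 𝒜) : (hsSq τ a : ℂ) = τ (star a * a) :=
  (Complex.eq_re_of_ofReal_le (map_nonneg τ (star_mul_self_nonneg a))).symm

theorem norm_trace_star_mul_le (a b : 𝒜) :
    ‖τ (star a * b)‖ ≤ √(hsSq τ a) * √(hsSq τ b) :=
  norm_inner_le_norm (𝕜 := ℂ) (τ.toPreGNS a) (τ.toPreGNS b)

theorem hsSq_unitary_mul {u : 𝒜} (hu : u ∈ unitary 𝒜) (a : 𝒜) : hsSq τ (u * a) = hsSq τ a := by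
  rw [hsSq, hsSq, star_mul, mul_assoc, ← mul_assoc (star u), Unitary.star_mul_self_of_mem hu, one_mul]

variable {τ} (hτ : ∀ a b, τ (a * b) = τ (b * a))
include hτ

theorem hsSq_star (a : 𝒜) : hsSq τ (star a) = hsSq τ a := by
  rw [hsSq, hsSq, hτ, star_star]

theorem hsSq_mul_unitary {u : 𝒜} (hu : u ∈ unitary 𝒜) (a : 𝒜) : hsSq τ (a * u) = hsSq τ a := by
  rw [← hsSq_star hτ, star_mul, hsSq_unitary_mul τ (Unitary.star_mem hu), hsSq_star hτ]

theorem hsSq_mul_le (a b : 𝒜) : hsSq τ (a * b) ≤ ‖b‖ ^ 2 * hsSq τ a := by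
  have h : a * (b * star b) * star a ≤ (‖b‖ ^ 2) • (a * star a) := by
    have := star_right_conjugate_le_conjugate (CStarAlgebra.mul_star_le_algebraMap_norm_sq (a := b)) a
    simpa [Algebra.algebraMap_eq_smul_one] using this
  have h2 := (Complex.le_def.1 (OrderHomClass.mono τ h)).1
  rw [← hsSq_star hτ, ← hsSq_star hτ a, hsSq, hsSq]
  rw [← Complex.coe_smul, map_smul] at h2
  simpa [mul_assoc, ← Complex.ofReal_pow] using h2

end Trace

/-! ### Interpolation of twisted maps -/

section Twisted
open NormedSpace
open scoped ComplexOrder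
variable {𝒜 : Type*} [CStarAlgebra 𝒜] [PartialOrder 𝒜] [StarOrderedRing 𝒜]

/-- The map `X ↦ φ(B)^{-a} φ(B^a X C^b) φ(C)^{-b}` for complex exponents `a` and `b`, where complex
powers are written as exponentials of multiples of the logarithm. -/
noncomputable def twistedMap (φ : 𝒜 →CP 𝒜) (B C : 𝒜) (a b : ℂ) (X : 𝒜) : 𝒜 :=
  exp (-a • CFC.log (φ B)) * φ (exp (a • CFC.log B) * X * exp (b • CFC.log C)) *
    exp (-b • CFC.log (φ C))

variable (φ : 𝒜 →CP 𝒜) (B C : 𝒜)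

theorem twistedMap_eq_re_im (a b : ℂ) (X : 𝒜) :
    twistedMap φ B C a b X =
      exp (((-a.im : ℝ) * Complex.I : ℂ) • CFC.log (φ B)) *
        twistedMap φ B C a.re b.re (exp ((a.im * Complex.I : ℂ) • CFC.log B) * X *
          exp ((b.im * Complex.I : ℂ) • CFC.log C)) *
        exp (((-b.im : ℝ) * Complex.I : ℂ) • CFC.log (φ C)) := by
  unfold twistedMap
  rw [exp_smul_re_im (CFC.log B) a, exp_smul_im_re (CFC.log C) b,
    exp_smul_im_re (CFC.log (φ B)) (-a), exp_smul_re_im (CFC.log (φ C)) (-b)]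
  simp only [mul_assoc, Complex.neg_re, Complex.neg_im, Complex.ofReal_neg]

theorem star_twistedMap (a b : ℝ) (X : 𝒜) :
    star (twistedMap φ B C a b X) = twistedMap φ C B b a (star X) := by
  have h (x : 𝒜) : φ (star x) = star (φ x) := map_star φ x
  have hl (x : 𝒜) (z : ℂ) : star (exp (z • CFC.log x)) = exp (star z • CFC.log x) :=
    star_exp_smul .log z
  simp only [twistedMap, star_mul, ← h, hl, mul_assoc]
  simp

/-- Whether the twisted map contracts the Hilbert-Schmidt norm depends only on the real parts of the
exponents. -/
theorem hsSq_twistedMap_le_of_re (τ : 𝒜 →ₚ[ℂ] ℂ) (hτ : ∀ x y, τ (x * y) = τ (y * x)) {a b : ℂ}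
    (h : ∀ X, hsSq τ (twistedMap φ B C a.re b.re X) ≤ hsSq τ X) (X : 𝒜) :
    hsSq τ (twistedMap φ B C a b X) ≤ hsSq τ X := by
  rw [twistedMap_eq_re_im, hsSq_mul_unitary hτ (exp_smul_I_mem_unitary .log _),
    hsSq_unitary_mul _ (exp_smul_I_mem_unitary .log _)]
  refine (h _).trans_eq ?_
  rw [hsSq_mul_unitary hτ (exp_smul_I_mem_unitary .log _),
    hsSq_unitary_mul _ (exp_smul_I_mem_unitary .log _)]

variable {φ B C}

theorem norm_twistedMap_le_of_re_eq_zero (hφ : φ 1 = 1) {a b : ℂ} (ha : a.re = 0) (hb : b.re = 0)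
    (X : 𝒜) : ‖twistedMap φ B C a b X‖ ≤ ‖X‖ := by
  rw [twistedMap_eq_re_im, CStarRing.norm_mul_mem_unitary _ (exp_smul_I_mem_unitary .log _),
    CStarRing.norm_mem_unitary_mul _ (exp_smul_I_mem_unitary .log _), ha, hb]
  simp only [twistedMap, Complex.ofReal_zero, neg_zero, zero_smul, exp_zero, one_mul, mul_one]
  refine (φ.norm_map_le hφ _).trans_eq ?_
  rw [CStarRing.norm_mul_mem_unitary _ (exp_smul_I_mem_unitary .log _),
    CStarRing.norm_mem_unitary_mul _ (exp_smul_I_mem_unitary .log _)]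

section Endpoints
variable {τ : 𝒜 →ₚ[ℂ] ℂ} (hτφ : ∀ x, τ (φ x) = τ x) (hφ : φ 1 = 1)
include hτφ hφ

theorem hsSq_twistedMap_zero_zero_le (X : 𝒜) :
    hsSq τ (twistedMap φ B C (0 : ℝ) (0 : ℝ) X) ≤ hsSq τ X := by
  simp only [twistedMap, Complex.ofReal_zero, neg_zero, zero_smul, exp_zero, one_mul, mul_one]
  have := (Complex.le_def.1 (OrderHomClass.mono τ (φ.star_mul_le hφ X))).1
  rwa [hτφ] at this

theorem hsSq_twistedMap_half_zero_le (hB : IsStrictlyPositive B) (X : 𝒜) :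
    hsSq τ (twistedMap φ B C (1 / 2 : ℝ) (0 : ℝ) X) ≤ hsSq τ X := by
  have hφB := hB.map_cp φ hφ
  simp only [twistedMap, Complex.ofReal_zero, neg_zero, zero_smul, exp_zero, mul_one]
  have h1 := (Complex.le_def.1 (OrderHomClass.mono τ
    (φ.star_mul_inv_mul_le hφ hB (B ^ (1 / 2 : ℝ) * X)))).1
  rw [hτφ] at h1
  rw [← Complex.ofReal_neg, ← hB.rpow_eq_exp, ← hφB.rpow_eq_exp]
  have e1 : star (B ^ (1 / 2 : ℝ)) = B ^ (1 / 2 : ℝ) := CFC.rpow_nonneg.isSelfAdjoint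
  have e2 : star (φ B ^ (-(1 / 2) : ℝ)) = φ B ^ (-(1 / 2) : ℝ) := CFC.rpow_nonneg.isSelfAdjoint
  have e3 : φ B ^ (-(1 / 2) : ℝ) * φ B ^ (-(1 / 2) : ℝ) = φ B ^ (-1 : ℝ) := by
    rw [← CFC.rpow_add hφB.isUnit]; norm_num
  have e4 : B ^ (1 / 2 : ℝ) * (B ^ (-1 : ℝ) * B ^ (1 / 2 : ℝ)) = 1 := by
    rw [← CFC.rpow_add hB.isUnit, ← CFC.rpow_add hB.isUnit]; norm_num; exact CFC.rpow_zero B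
  convert h1 using 3
  · rw [hsSq, star_mul, e2, ← e3]; simp only [mul_assoc]
  · have h : star X * X = star (B ^ (1 / 2 : ℝ) * X) * B ^ (-1 : ℝ) * (B ^ (1 / 2 : ℝ) * X) := by
      calc star X * X = star X * (B ^ (1 / 2 : ℝ) * (B ^ (-1 : ℝ) * B ^ (1 / 2 : ℝ))) * X := by
            rw [e4, mul_one]
        _ = _ := by rw [star_mul, e1]; simp only [mul_assoc]
    rw [hsSq, h]

theorem hsSq_twistedMap_zero_half_le (hτ : ∀ x y, τ (x * y) = τ (y * x))
    (hC : IsStrictlyPositive C) (X : 𝒜) :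
    hsSq τ (twistedMap φ B C (0 : ℝ) (1 / 2 : ℝ) X) ≤ hsSq τ X := by
  rw [← hsSq_star hτ, star_twistedMap, ← hsSq_star hτ X]
  exact hsSq_twistedMap_half_zero_le hτφ hφ hC _

end Endpoints

/-- The three lines theorem for `z ↦ τ (W z * T_{a(z), b(z)} (X z))`, where `T` is the twisted map, the
exponents `a`, `b` are affine in `z` with real coefficients, and `W`, `X` are holomorphic families
bounded on the strip. -/
theorem norm_twistedMap_three_lines (τ : 𝒜 →ₚ[ℂ] ℂ) {W X : ℂ → 𝒜}
    (hW : Differentiable ℂ W) (hX : Differentiable ℂ X)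
    (hWb : ∃ M, ∀ z : ℂ, z.re ∈ Set.Icc (0 : ℝ) 1 → ‖W z‖ ≤ M)
    (hXb : ∃ M, ∀ z : ℂ, z.re ∈ Set.Icc (0 : ℝ) 1 → ‖X z‖ ≤ M)
    (a₀ a₁ b₀ b₁ : ℝ) {m₀ m₁ : ℝ}
    (h₀ : ∀ z : ℂ, z.re = 0 →
      ‖τ (W z * twistedMap φ B C (a₀ + a₁ * z) (b₀ + b₁ * z) (X z))‖ ≤ m₀)
    (h₁ : ∀ z : ℂ, z.re = 1 →
      ‖τ (W z * twistedMap φ B C (a₀ + a₁ * z) (b₀ + b₁ * z) (X z))‖ ≤ m₁)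
    {θ : ℝ} (hθ : θ ∈ Set.Icc (0 : ℝ) 1) :
    ‖τ (W θ * twistedMap φ B C (a₀ + a₁ * θ) (b₀ + b₁ * θ) (X θ))‖ ≤
      m₀ ^ (1 - θ) * m₁ ^ θ := by
  let Φ : 𝒜 →L[ℂ] 𝒜 := ⟨φ.toLinearMap, map_continuous φ⟩
  let T : 𝒜 →L[ℂ] ℂ := ⟨τ.toLinearMap, map_continuous τ⟩
  let F : ℂ → 𝒜 := fun z => W z *
    (exp (((-a₀ : ℝ) + (-a₁ : ℝ) * z : ℂ) • CFC.log (φ B)) *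
      Φ (exp ((a₀ + a₁ * z : ℂ) • CFC.log B) * X z * exp ((b₀ + b₁ * z : ℂ) • CFC.log C)) *
    exp (((-b₀ : ℝ) + (-b₁ : ℝ) * z : ℂ) • CFC.log (φ C)))
  have hF : ∀ z, F z = W z * twistedMap φ B C (a₀ + a₁ * z) (b₀ + b₁ * z) (X z) := fun z => by
    have e1 : -(a₀ + a₁ * z : ℂ) = (-a₀ : ℝ) + (-a₁ : ℝ) * z := by push_cast; ring
    have e2 : -(b₀ + b₁ * z : ℂ) = (-b₀ : ℝ) + (-b₁ : ℝ) * z := by push_cast; ring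
    simp only [F, twistedMap, e1, e2]
    rfl
  have hexp (L : 𝒜) (α β : ℝ) : Differentiable ℂ fun z : ℂ => exp ((α + β * z : ℂ) • L) :=
    (differentiable_exp_smul L).comp (by fun_prop)
  have hFd : Differentiable ℂ F :=
    hW.mul (((hexp _ _ _).mul (Φ.differentiable.comp
      (((hexp _ _ _).mul hX).mul (hexp _ _ _)))).mul (hexp _ _ _))
  obtain ⟨K₁, hK₁⟩ := hWb
  obtain ⟨K₂, hK₂⟩ := hXb
  obtain ⟨K₃, hK₃⟩ := exists_norm_exp_smul_le (L := CFC.log (φ B)) .log (-a₀) (-a₁)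
  obtain ⟨K₄, hK₄⟩ := exists_norm_exp_smul_le (L := CFC.log B) .log a₀ a₁
  obtain ⟨K₅, hK₅⟩ := exists_norm_exp_smul_le (L := CFC.log C) .log b₀ b₁
  obtain ⟨K₆, hK₆⟩ := exists_norm_exp_smul_le (L := CFC.log (φ C)) .log (-b₀) (-b₁)
  have hFb : ∀ z : ℂ, z.re ∈ Set.Icc (0 : ℝ) 1 →
      ‖F z‖ ≤ K₁ * (K₃ * (‖Φ‖ * (K₄ * K₂ * K₅)) * K₆) := by
    intro z hz
    exact norm_mul_le_of_le (hK₁ z hz) (norm_mul_le_of_le (norm_mul_le_of_le (hK₃ z hz)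
      (Φ.le_of_opNorm_le_of_le le_rfl (norm_mul_le_of_le (norm_mul_le_of_le (hK₄ z hz) (hK₂ z hz))
        (hK₅ z hz)))) (hK₆ z hz))
  have key := Complex.HadamardThreeLines.norm_le_interp_of_mem_verticalClosedStrip₀₁'
    (fun z => T (F z)) (z := (θ : ℂ)) (a := m₀) (b := m₁)
    (by simpa [Complex.HadamardThreeLines.verticalClosedStrip] using hθ)
    (T.differentiable.comp hFd).diffContOnCl
    ⟨‖T‖ * (K₁ * (K₃ * (‖Φ‖ * (K₄ * K₂ * K₅)) * K₆)), by
      rintro _ ⟨z, hz, rfl⟩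
      exact T.le_of_opNorm_le_of_le le_rfl (hFb z hz)⟩
    (fun z hz => by simp only [hF]; exact h₀ z hz) (fun z hz => by simp only [hF]; exact h₁ z hz)
  simp only [hF, Complex.ofReal_re] at key
  exact key

/-- The real exponents for which the twisted map is a Hilbert-Schmidt contraction form a convex
set. -/
theorem hsSq_twistedMap_le_of_convex (τ : 𝒜 →ₚ[ℂ] ℂ) (hτ : ∀ x y, τ (x * y) = τ (y * x))
    {a₀ a₁ b₀ b₁ : ℝ}
    (h₀ : ∀ X, hsSq τ (twistedMap φ B C a₀ b₀ X) ≤ hsSq τ X)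
    (h₁ : ∀ X, hsSq τ (twistedMap φ B C a₁ b₁ X) ≤ hsSq τ X)
    {θ : ℝ} (hθ : θ ∈ Set.Icc (0 : ℝ) 1) (X : 𝒜) :
    hsSq τ (twistedMap φ B C (a₀ + (a₁ - a₀) * θ : ℝ) (b₀ + (b₁ - b₀) * θ : ℝ) X) ≤ hsSq τ X := by
  -- Testing against `star Y` recovers the squared norm of `Y` at the point `θ`.
  set Y := twistedMap φ B C (a₀ + (a₁ - a₀) * θ : ℝ) (b₀ + (b₁ - b₀) * θ : ℝ) X with hY
  have hy := hsSq_nonneg τ Y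
  have hx := hsSq_nonneg τ X
  have bound (z : ℂ) (h : ∀ X, hsSq τ (twistedMap φ B C
      ((a₀ + (a₁ - a₀ : ℝ) * z : ℂ).re : ℝ) ((b₀ + (b₁ - b₀ : ℝ) * z : ℂ).re : ℝ) X) ≤ hsSq τ X) :
      ‖τ (star Y * twistedMap φ B C (a₀ + (a₁ - a₀ : ℝ) * z) (b₀ + (b₁ - b₀ : ℝ) * z) X)‖
        ≤ √(hsSq τ Y) * √(hsSq τ X) :=
    (norm_trace_star_mul_le τ _ _).trans (by
      gcongr
      exact hsSq_twistedMap_le_of_re φ B C τ hτ h X)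
  have key := norm_twistedMap_three_lines (φ := φ) (B := B) (C := C) τ (W := fun _ => star Y)
    (X := fun _ => X) (differentiable_const _) (differentiable_const _) ⟨_, fun _ _ => le_rfl⟩
    ⟨_, fun _ _ => le_rfl⟩ a₀ (a₁ - a₀) b₀ (b₁ - b₀)
    (fun z hz => bound z (by simpa [hz] using h₀)) (fun z hz => bound z (by simpa [hz] using h₁)) hθ
  rw [← Real.rpow_add_of_nonneg (by positivity) (sub_nonneg.2 hθ.2) hθ.1] at key
  have e : τ (star Y * twistedMap φ B C (a₀ + (a₁ - a₀ : ℝ) * θ) (b₀ + (b₁ - b₀ : ℝ) * θ) X) =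
      hsSq τ Y := by
    rw [coe_hsSq, hY]; push_cast; rfl
  rw [e, Complex.norm_real, Real.norm_of_nonneg hy, sub_add_cancel, Real.rpow_one] at key
  rcases hy.eq_or_lt with h | h
  · rw [← h]; exact hx
  · have h2 : √(hsSq τ Y) * √(hsSq τ Y) ≤ √(hsSq τ Y) * √(hsSq τ X) := by
      rwa [Real.mul_self_sqrt hy]
    exact (Real.sqrt_le_sqrt_iff hx).1 (le_of_mul_le_mul_left h2 (Real.sqrt_pos.2 h))

/-- Every point of the triangle is reached by interpolating first along the edge from `(1/2, 0)` to
`(0, 1/2)`, and then between a point of this edge and the vertex `(0, 0)`. -/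
theorem hsSq_twistedMap_le {τ : 𝒜 →ₚ[ℂ] ℂ} (hτ : ∀ x y, τ (x * y) = τ (y * x))
    (hτφ : ∀ x, τ (φ x) = τ x) (hφ : φ 1 = 1) (hB : IsStrictlyPositive B)
    (hC : IsStrictlyPositive C) {a b : ℝ} (ha : 0 < a) (hb : 0 < b) (hab : a + b ≤ 1 / 2) (X : 𝒜) :
    hsSq τ (twistedMap φ B C a b X) ≤ hsSq τ X := by
  have hs : 0 < a + b := by positivity
  have h1 := hsSq_twistedMap_le_of_convex (φ := φ) τ hτ
    (hsSq_twistedMap_half_zero_le (B := B) (C := C) hτφ hφ hB)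
    (hsSq_twistedMap_zero_half_le hτφ hφ hτ hC) (θ := b / (a + b))
    ⟨by positivity, (div_le_one hs).2 (by linarith)⟩
  have h2 := hsSq_twistedMap_le_of_convex (φ := φ) τ hτ
    (hsSq_twistedMap_zero_zero_le hτφ hφ) h1 (θ := 2 * (a + b))
    ⟨by positivity, by linarith⟩ X
  convert h2 using 4
  · field_simp; ring
  · field_simp; ring

end Twisted

/-! ### Exponential polar decomposition and Stein interpolation -/

section Polar
open NormedSpace
open scoped ComplexOrder
variable {𝒜 : Type*} [CStarAlgebra 𝒜] [PartialOrder 𝒜] [StarOrderedRing 𝒜]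

/-- A polar decomposition `Z = V exp L` with `‖V‖ ≤ 1` and `L` self-adjoint, so that `V exp (z • L)` is
an entire family of operators which plays the role of `V |Z| ^ z`. Finiteness of the spectrum makes
every function admissible in the functional calculus; in particular `L = log |Z|` and
`V = Z |Z|⁻¹` may be formed with the conventions `log 0 = 0` and `0⁻¹ = 0`. Then `V` is a partial
isometry vanishing on the kernel of `Z`, and the value of `exp L` on this kernel is irrelevant. -/
theorem exists_polar_exp {Z : 𝒜} (hfin : (spectrum ℝ (CFC.abs Z)).Finite) :
    ∃ V L : 𝒜, IsSelfAdjoint L ∧ ‖V‖ ≤ 1 ∧ V * exp L = Z ∧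
      (∀ x y : ℝ, 0 < x + y → star (V * exp ((x : ℂ) • L)) * (V * exp ((y : ℂ) • L)) =
        CFC.abs Z ^ (x + y)) ∧
      ∀ x y : ℝ, V * exp (((x + y : ℝ) : ℂ) • L) =
        V * exp ((x : ℂ) • L) * star V * (V * exp ((y : ℂ) • L)) := by
  set R := CFC.abs Z with hR
  have hR0 : 0 ≤ R := CFC.abs_nonneg Z
  have hRsa : IsSelfAdjoint R := hR0.isSelfAdjoint
  have hc (f : ℝ → ℝ) : ContinuousOn f (spectrum ℝ R) := hfin.continuousOn f
  have hRR : star Z * Z = R * R := (CFC.abs_mul_abs Z).symm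
  have hid : cfc (fun t : ℝ => t) R = R := cfc_id' ℝ R
  have hsp : ∀ t ∈ spectrum ℝ R, 0 ≤ t := fun t ht => spectrum_nonneg_of_nonneg hR0 ht
  have hmul (f g : ℝ → ℝ) : cfc f R * cfc g R = cfc (fun t => f t * g t) R :=
    (cfc_mul f g R (hc f) (hc g)).symm
  have hstar (f : ℝ → ℝ) : star (cfc f R) = cfc f R := (cfc_predicate f R : IsSelfAdjoint _)
  set V := Z * cfc (fun t : ℝ => t⁻¹) R with hV
  set L := cfc Real.log R with hL
  -- `P` is the projection onto the orthogonal complement of the kernel of `Z`.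
  set P := cfc (fun t : ℝ => t⁻¹ * t * (t * t⁻¹)) R with hP
  have hLsa : IsSelfAdjoint L := cfc_predicate _ _
  have hexp (x : ℝ) : exp ((x : ℂ) • L) = cfc (fun t => Real.exp (x * Real.log t)) R :=
    CFC.cfc_exp_smul hRsa (hc _) x
  have hVV : star V * V = P := by
    calc star V * V = cfc (fun t : ℝ => t⁻¹) R * (star Z * Z) * cfc (fun t : ℝ => t⁻¹) R := by
          rw [hV, star_mul, hstar]; simp only [mul_assoc]
      _ = (cfc (fun t : ℝ => t⁻¹) R * cfc (fun t : ℝ => t) R) *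
            (cfc (fun t : ℝ => t) R * cfc (fun t : ℝ => t⁻¹) R) := by
          rw [hRR, hid]; simp only [mul_assoc]
      _ = P := by rw [hmul, hmul, hmul]
  have hZ0 (f : ℝ → ℝ) (hf : ∀ t ∈ spectrum ℝ R, f t * (t * (t * f t)) = 0) : Z * cfc f R = 0 := by
    rw [← CStarRing.star_mul_self_eq_zero_iff]
    calc star (Z * cfc f R) * (Z * cfc f R) = cfc f R * (star Z * Z) * cfc f R := by
          rw [star_mul, hstar]; simp only [mul_assoc]
      _ = cfc f R * (cfc (fun t : ℝ => t) R * (cfc (fun t : ℝ => t) R * cfc f R)) := by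
          rw [hRR, hid]; simp only [mul_assoc]
      _ = cfc (fun _ : ℝ => (0 : ℝ)) R := by
          rw [hmul, hmul, hmul]; exact cfc_congr hf
      _ = 0 := cfc_const_zero ℝ R
  have hZcongr (f g : ℝ → ℝ) (hfg : ∀ t ∈ spectrum ℝ R, t ≠ 0 → f t = g t) :
      Z * cfc f R = Z * cfc g R := by
    rw [← sub_eq_zero, ← mul_sub, ← cfc_sub f g R (hc f) (hc g)]
    refine hZ0 _ fun t ht => ?_
    rcases eq_or_ne t 0 with rfl | h0
    · simp
    · simp [hfg t ht h0]
  refine ⟨V, L, hLsa, ?_, ?_, ?_, ?_⟩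
  · have h1 : P ≤ algebraMap ℝ 𝒜 (1 ^ 2) := by
      rw [one_pow]
      refine cfc_le_algebraMap _ _ R (fun t ht => ?_) (hc _)
      rcases eq_or_ne t 0 with rfl | h0
      · simp
      · simp [h0]
    rw [← hVV] at h1
    have h2 := (CStarAlgebra.norm_le_iff_le_algebraMap _ (by positivity)
      (star_mul_self_nonneg _)).2 h1
    rw [CStarRing.norm_star_mul_self, ← sq] at h2
    exact le_of_sq_le_sq h2 zero_le_one
  · have h1 := hexp 1
    rw [Complex.ofReal_one, one_smul] at h1
    rw [h1, hV, mul_assoc, hmul]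
    conv_rhs => rw [← mul_one Z, ← cfc_const_one ℝ R]
    refine hZcongr _ _ fun t ht h0 => ?_
    rw [one_mul, Real.exp_log (lt_of_le_of_ne (hsp t ht) h0.symm), inv_mul_cancel₀ h0]
  · intro x y hxy
    calc star (V * exp ((x : ℂ) • L)) * (V * exp ((y : ℂ) • L))
        = cfc (fun t => Real.exp (x * Real.log t)) R * (star V * V) *
            cfc (fun t => Real.exp (y * Real.log t)) R := by
          rw [hexp, hexp, star_mul, hstar]; simp only [mul_assoc]
      _ = R ^ (x + y) := by
          rw [hVV, hmul, hmul, CFC.rpow_eq_cfc_real hR0]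
          refine cfc_congr fun t ht => ?_
          rcases eq_or_ne t 0 with rfl | h0
          · simp [Real.zero_rpow hxy.ne']
          · have ht0 : 0 < t := lt_of_le_of_ne (hsp t ht) h0.symm
            rw [inv_mul_cancel₀ h0, mul_inv_cancel₀ h0, mul_one, mul_one, ← Real.exp_add,
              Real.rpow_def_of_pos ht0]
            congr 1; ring
  · intro x y
    have e : V * exp ((x : ℂ) • L) * star V * (V * exp ((y : ℂ) • L)) =
        V * exp ((x : ℂ) • L) * (star V * V) * exp ((y : ℂ) • L) := by simp only [mul_assoc]
    rw [e, hVV, hexp, hexp, hexp, hV, hP]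
    simp only [mul_assoc, hmul]
    refine hZcongr _ _ fun t ht h0 => ?_
    rw [mul_inv_cancel_left₀ h0, inv_mul_cancel_left₀ h0, add_mul, Real.exp_add]

/-- The inequality in a C⋆-algebra whose elements have finite spectra, for a tracial functional `τ`
preserved by `φ`. Write `Z` and `Y` for the two products, with polar decompositions `Z = V exp L` and
`Y = U exp K`, and `T` for the twisted map. The three lines theorem is applied to
`z ↦ τ (exp (s (1 + z) / 2 • K) U* T_{a(z), b(z)} (V exp (s (1 - z) / 2 • L)))`
with `a(z) = p s (1 - z) / 2` and `b(z) = q s (1 - z) / 2`. At `θ = 1 - 2 / s` the value is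
`τ (|Y| ^ s)`. -/
theorem trace_abs_rpow_le {φ : 𝒜 →CP 𝒜} {τ : 𝒜 →ₚ[ℂ] ℂ} (hτ : ∀ x y, τ (x * y) = τ (y * x))
    (hτφ : ∀ x, τ (φ x) = τ x) (hφ : φ 1 = 1) (hfin : ∀ x : 𝒜, (spectrum ℝ x).Finite)
    {B C : 𝒜} (hB : IsStrictlyPositive B) (hC : IsStrictlyPositive C) (A : 𝒜)
    {p q s : ℝ} (hp : 0 < p) (hq : 0 < q) (hs : 2 ≤ s) (hs' : s * (p + q) ≤ 1) :
    (τ (CFC.abs (φ B ^ (-p) * φ A * φ C ^ (-q)) ^ s)).re ≤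
      (τ (CFC.abs (B ^ (-p) * A * C ^ (-q)) ^ s)).re := by
  have hφB := hB.map_cp φ hφ
  have hφC := hC.map_cp φ hφ
  set Z := B ^ (-p) * A * C ^ (-q) with hZ
  set Y := φ B ^ (-p) * φ A * φ C ^ (-q) with hY
  have hs0 : 0 < s := by linarith
  have hTZ : twistedMap φ B C p q Z = Y := by
    have e : B ^ p * Z * C ^ q = A := by
      calc B ^ p * Z * C ^ q = (B ^ p * B ^ (-p)) * A * (C ^ (-q) * C ^ q) := by
            rw [hZ]; simp only [mul_assoc]
        _ = A := by rw [CFC.rpow_mul_rpow_neg p, CFC.rpow_neg_mul_rpow q, one_mul, mul_one]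
    rw [twistedMap, ← hB.rpow_eq_exp, ← hC.rpow_eq_exp, e, ← Complex.ofReal_neg,
      ← Complex.ofReal_neg, ← hφB.rpow_eq_exp, ← hφC.rpow_eq_exp]
  obtain ⟨V, L, hL, hV, hVL, hVabs, -⟩ := exists_polar_exp (hfin (CFC.abs Z))
  obtain ⟨U, K, hK, hU, hUK, hUabs, hUadd⟩ := exists_polar_exp (hfin (CFC.abs Y))
  set G := U * exp (((s / 2 : ℝ) : ℂ) • K) with hG
  set D := V * exp (((s / 2 : ℝ) : ℂ) • L) with hD
  have hGs : hsSq τ G = (τ (CFC.abs Y ^ s)).re := by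
    rw [hsSq, hUabs _ _ (by linarith), add_halves]
  have hDs : hsSq τ D = (τ (CFC.abs Z ^ s)).re := by
    rw [hsSq, hVabs _ _ (by linarith), add_halves]
  rw [← hGs, ← hDs]
  have hg := hsSq_nonneg τ G
  have hd := hsSq_nonneg τ D
  let θ : ℝ := 1 - 2 / s
  have hθ : θ ∈ Set.Icc (0 : ℝ) 1 :=
    ⟨sub_nonneg.2 ((div_le_one hs0).2 hs), sub_le_self _ (by positivity)⟩
  let W : ℂ → 𝒜 := fun z => exp (((s / 2 : ℝ) + (s / 2 : ℝ) * z : ℂ) • K) * star U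
  let X : ℂ → 𝒜 := fun z => V * exp (((s / 2 : ℝ) + (-(s / 2) : ℝ) * z : ℂ) • L)
  have hexp (L : 𝒜) (α β : ℝ) : Differentiable ℂ fun z : ℂ => exp ((α + β * z : ℂ) • L) :=
    (differentiable_exp_smul L).comp (by fun_prop)
  have key := norm_twistedMap_three_lines (φ := φ) (B := B) (C := C) τ (W := W) (X := X)
    ((hexp _ _ _).mul_const _) ((hexp _ _ _).const_mul _)
    (by
      obtain ⟨M, hM⟩ := exists_norm_exp_smul_le hK (s / 2) (s / 2)
      exact ⟨M * ‖star U‖, fun z hz => norm_mul_le_of_le (hM z hz) le_rfl⟩)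
    (by
      obtain ⟨M, hM⟩ := exists_norm_exp_smul_le hL (s / 2) (-(s / 2))
      exact ⟨‖V‖ * M, fun z hz => norm_mul_le_of_le le_rfl (hM z hz)⟩)
    (p * s / 2) (-(p * s / 2)) (q * s / 2) (-(q * s / 2))
    (m₀ := √(hsSq τ G) * √(hsSq τ D)) (m₁ := hsSq τ G) ?_ ?_ hθ
  -- At `θ` the exponents are `p` and `q`, and the families take the values `Z` and `|Y| ^ (s - 1) U*`.
  · have e1 : (((p * s / 2 : ℝ) : ℂ) + (-(p * s / 2) : ℝ) * θ) = (p : ℝ) := by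
      rw [← Complex.ofReal_mul, ← Complex.ofReal_add]
      congr 1; simp only [θ]; field_simp; ring
    have e2 : (((q * s / 2 : ℝ) : ℂ) + (-(q * s / 2) : ℝ) * θ) = (q : ℝ) := by
      rw [← Complex.ofReal_mul, ← Complex.ofReal_add]
      congr 1; simp only [θ]; field_simp; ring
    have e3 : X θ = Z := by
      have : (((s / 2 : ℝ) : ℂ) + (-(s / 2) : ℝ) * θ) = ((1 : ℝ) : ℂ) := by
        rw [← Complex.ofReal_mul, ← Complex.ofReal_add]
        congr 1; simp only [θ]; field_simp; ring
      simp only [X, this, Complex.ofReal_one, one_smul, hVL]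
    have e4 : W θ = star (U * exp (((s - 1 : ℝ) : ℂ) • K)) := by
      have : (((s / 2 : ℝ) : ℂ) + (s / 2 : ℝ) * θ) = ((s - 1 : ℝ) : ℂ) := by
        rw [← Complex.ofReal_mul, ← Complex.ofReal_add]
        congr 1; simp only [θ]; field_simp; ring
      rw [star_mul, star_exp_smul hK]
      simp only [W, this]
      simp
    have e5 : τ (W θ * Y) = hsSq τ G := by
      have h1 : U * exp (((1 : ℝ) : ℂ) • K) = Y := by
        rw [Complex.ofReal_one, one_smul, hUK]
      rw [e4, ← h1, hUabs _ _ (by linarith), sub_add_cancel, coe_hsSq, hUabs _ _ (by linarith),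
        add_halves]
    rw [e1, e2, e3, hTZ, e5, Complex.norm_real, Real.norm_of_nonneg hg] at key
    rcases hg.eq_or_lt with h | h
    · rw [← h]; exact hd
    · have hθ1 : 0 < 1 - θ := by simp only [θ]; ring_nf; positivity
      have h2 : hsSq τ G ^ (1 - θ) ≤ (√(hsSq τ G) * √(hsSq τ D)) ^ (1 - θ) := by
        refine le_of_mul_le_mul_right ?_ (Real.rpow_pos_of_pos h θ)
        rwa [← Real.rpow_add h, sub_add_cancel, Real.rpow_one]
      have h3 := (Real.rpow_le_rpow_iff hg (by positivity) hθ1).1 h2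
      have h4 : √(hsSq τ G) * √(hsSq τ G) ≤ √(hsSq τ G) * √(hsSq τ D) := by
        rwa [Real.mul_self_sqrt hg]
      exact (Real.sqrt_le_sqrt_iff hd).1 (le_of_mul_le_mul_left h4 (Real.sqrt_pos.2 h))
  -- On `re z = 0`: the Cauchy-Schwarz inequality and the Hilbert-Schmidt contraction.
  · intro z hz
    have hWz : W z = star (G * exp (((-(s / 2 * z.im) : ℝ) * Complex.I : ℂ) • K)) := by
      rw [hG, mul_assoc, ← exp_add_smul, star_mul, star_exp_smul hK]
      simp only [W]
      congr 3
      apply Complex.ext <;> simp [hz]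
    have hXz : X z = D * exp (((-(s / 2 * z.im) : ℝ) * Complex.I : ℂ) • L) := by
      rw [hD, mul_assoc, ← exp_add_smul]
      simp only [X]
      congr 3
      apply Complex.ext <;> simp [hz]
    rw [hWz]
    refine (norm_trace_star_mul_le τ _ _).trans ?_
    rw [hsSq_mul_unitary hτ (exp_smul_I_mem_unitary hK _)]
    gcongr
    refine (hsSq_twistedMap_le_of_re φ B C τ hτ (fun T => ?_) _).trans ?_
    · have ha : (((p * s / 2 : ℝ) : ℂ) + (-(p * s / 2) : ℝ) * z).re = p * s / 2 := by simp [hz]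
      have hb : (((q * s / 2 : ℝ) : ℂ) + (-(q * s / 2) : ℝ) * z).re = q * s / 2 := by simp [hz]
      rw [ha, hb]
      exact hsSq_twistedMap_le hτ hτφ hφ hB hC (by positivity) (by positivity) (by linarith) T
    · rw [hXz, hsSq_mul_unitary hτ (exp_smul_I_mem_unitary hL _)]
  -- On `re z = 1`: duality between the trace norm and the operator norm.
  · intro z hz
    set T := twistedMap φ B C ((p * s / 2 : ℝ) + (-(p * s / 2) : ℝ) * z)
      ((q * s / 2 : ℝ) + (-(q * s / 2) : ℝ) * z) (X z) with hT
    have hTn : ‖T‖ ≤ 1 := by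
      refine (norm_twistedMap_le_of_re_eq_zero hφ (by simp [hz]) (by simp [hz]) _).trans ?_
      have hXz : X z = V * exp (((-(s / 2 * z.im) : ℝ) * Complex.I : ℂ) • L) := by
        simp only [X]
        congr 3
        apply Complex.ext <;> simp [hz]
      rw [hXz, CStarRing.norm_mul_mem_unitary _ (exp_smul_I_mem_unitary hL _)]
      exact hV
    have hWz : W z = star (G * exp (((-(s / 2 * z.im) : ℝ) * Complex.I : ℂ) • K)) *
        (U * star G) := by
      have h1 : W z = star (U * exp (((s / 2 + s / 2 : ℝ) : ℂ) • K) *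
          exp (((-(s / 2 * z.im) : ℝ) * Complex.I : ℂ) • K)) := by
        rw [mul_assoc, ← exp_add_smul, star_mul, star_exp_smul hK]
        simp only [W]
        congr 3
        apply Complex.ext <;> simp [hz]
      rw [h1, hUadd]
      simp only [star_mul, star_star, mul_assoc, hG]
    rw [hWz, mul_assoc]
    refine (norm_trace_star_mul_le τ _ _).trans ?_
    rw [hsSq_mul_unitary hτ (exp_smul_I_mem_unitary hK _)]
    have h1 : hsSq τ (U * star G * T) ≤ hsSq τ G := by
      refine (hsSq_mul_le hτ _ _).trans ?_
      have h2 : hsSq τ (U * star G) ≤ ‖star U‖ ^ 2 * hsSq τ G := by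
        rw [← hsSq_star hτ, star_mul, star_star]
        exact hsSq_mul_le hτ _ _
      rw [norm_star] at h2
      calc ‖T‖ ^ 2 * hsSq τ (U * star G) ≤ 1 * (1 * hsSq τ G) := by
            gcongr
            · exact hsSq_nonneg τ _
            · exact pow_le_one₀ (norm_nonneg _) hTn
            · refine h2.trans ?_
              gcongr
              exact pow_le_one₀ (norm_nonneg _) hU
        _ = hsSq τ G := by ring
    calc √(hsSq τ G) * √(hsSq τ (U * star G * T)) ≤ √(hsSq τ G) * √(hsSq τ G) := by gcongr
      _ = hsSq τ G := Real.mul_self_sqrt hg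

end Polar

/-! ### The trace on a Hilbert space -/

section HilbertSpace
open scoped ComplexOrder
variable {H : Type*} [NormedAddCommGroup H] [InnerProductSpace ℂ H] [CompleteSpace H]

theorem finiteDimensional_of_opTrace_lt_top {T : H →L[ℂ] H} (hT : IsStrictlyPositive T)
    (h : opTrace T < ∞) : FiniteDimensional ℂ H := by
  rcases subsingleton_or_nontrivial H with hH | hH
  · infer_instance
  obtain ⟨r, hr, hrT⟩ := (CFC.exists_pos_algebraMap_le_iff hT.isSelfAdjoint).2
    fun x hx => hT.spectrum_pos hx
  let w := (exists_hilbertBasis ℂ H).choose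
  obtain ⟨b, hb⟩ : ∃ b : HilbertBasis w ℂ H, ⇑b = ((↑) : w → H) :=
    (exists_hilbertBasis ℂ H).choose_spec
  have hle (e : w) : ENNReal.ofReal r ≤ ENNReal.ofReal (RCLike.re ⟪(e : H), T e⟫_ℂ) := by
    refine ENNReal.ofReal_le_ofReal ?_
    have h1 := (ContinuousLinearMap.le_def _ _).1 hrT
    have h2 := h1.re_inner_nonneg_right (e : H)
    have h3 : ‖(e : H)‖ = 1 := by rw [← congrFun hb e]; exact b.orthonormal.1 e
    rw [Algebra.algebraMap_eq_smul_one, sub_apply, inner_sub_right, map_sub,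
      smul_apply, one_apply_eq_self, ← Complex.coe_smul,
      inner_smul_right, inner_self_eq_norm_sq_to_K, h3] at h2
    simp at h2
    simpa using h2
  have hfin : Finite w := by
    by_contra hinf
    rw [not_finite_iff_infinite] at hinf
    have : ∑' _ : w, ENNReal.ofReal r = ∞ :=
      ENNReal.tsum_const_eq_top_of_ne_zero (ENNReal.ofReal_pos.2 hr).ne'
    exact absurd (this ▸ ENNReal.tsum_le_tsum hle) (not_le.2 h)
  have := Fintype.ofFinite w
  exact Module.Finite.of_basis b.toOrthonormalBasis.toBasis

/-- A Schatten class contains a strictly positive operator only in finite dimension. -/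
theorem finiteDimensional_of_memSchatten {T : H →L[ℂ] H} (hT : IsStrictlyPositive T) {r : ℝ}
    (h : MemSchatten r T) : FiniteDimensional ℂ H := by
  have h1 : CFC.abs T = T := CFC.abs_of_nonneg T hT.nonneg
  rw [MemSchatten, traceAbsPow, h1] at h
  exact finiteDimensional_of_opTrace_lt_top (IsStrictlyPositive.rpow T r) h

variable [FiniteDimensional ℂ H]

theorem finite_real_spectrum (T : H →L[ℂ] H) : (spectrum ℝ T).Finite := by
  rw [← spectrum.preimage_algebraMap ℂ]
  refine Set.Finite.preimage (FaithfulSMul.algebraMap_injective ℝ ℂ).injOn ?_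
  rw [← AlgEquiv.spectrum_eq (Module.End.toContinuousLinearMap (𝕜 := ℂ) H).symm T]
  exact Module.End.finite_spectrum _

variable (H) in
/-- The trace on the operators of a finite-dimensional Hilbert space, as a positive functional. -/
noncomputable def traceFunctional : (H →L[ℂ] H) →ₚ[ℂ] ℂ :=
  .mk₀ (LinearMap.trace ℂ H ∘ₗ ContinuousLinearMap.coeLM ℂ) fun T hT => by
    rw [LinearMap.comp_apply, LinearMap.trace_eq_sum_inner _ (stdOrthonormalBasis ℂ H)]
    exact Finset.sum_nonneg fun i _ =>
      ((ContinuousLinearMap.nonneg_iff_isPositive T).1 hT).inner_nonneg_right _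

theorem traceFunctional_apply (T : H →L[ℂ] H) :
    traceFunctional H T = LinearMap.trace ℂ H (T : H →ₗ[ℂ] H) := rfl

theorem traceFunctional_mul_comm (S T : H →L[ℂ] H) :
    traceFunctional H (S * T) = traceFunctional H (T * S) :=
  LinearMap.trace_mul_comm ℂ (S : H →ₗ[ℂ] H) (T : H →ₗ[ℂ] H)

theorem opTrace_eq_traceFunctional {T : H →L[ℂ] H} (hT : 0 ≤ T) :
    opTrace T = ENNReal.ofReal (traceFunctional H T).re := by
  rw [opTrace_eq_tsum (stdOrthonormalBasis ℂ H).toHilbertBasis hT, tsum_fintype,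
    ← ENNReal.ofReal_sum_of_nonneg, traceFunctional_apply,
    LinearMap.trace_eq_sum_inner _ (stdOrthonormalBasis ℂ H), Complex.re_sum]
  · simp
  · exact fun i _ =>
      ((ContinuousLinearMap.nonneg_iff_isPositive T).1 hT).re_inner_nonneg_right _

theorem IsUCPTP.traceFunctional_map {φ : (H →L[ℂ] H) →CP (H →L[ℂ] H)} (hφ : IsUCPTP φ)
    (T : H →L[ℂ] H) : traceFunctional H (φ T) = traceFunctional H T := by
  have h : (traceFunctional H).toLinearMap ∘ₗ φ.toLinearMap = (traceFunctional H).toLinearMap := by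
    refine LinearMap.ext_on CStarAlgebra.span_nonneg fun X hX => ?_
    have hX0 : 0 ≤ X := hX
    have hφX : 0 ≤ φ X := by simpa using OrderHomClass.mono φ hX0
    have h1 := hφ.trace_preserving X hX0
    have p1 : 0 ≤ traceFunctional H X := map_nonneg _ hX0
    have p2 : 0 ≤ traceFunctional H (φ X) := map_nonneg _ hφX
    rw [opTrace_eq_traceFunctional hX0, opTrace_eq_traceFunctional hφX,
      ENNReal.ofReal_eq_ofReal_iff (Complex.le_def.1 p2).1 (Complex.le_def.1 p1).1] at h1
    change traceFunctional H (φ X) = traceFunctional H X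
    rw [Complex.eq_re_of_ofReal_le p1, Complex.eq_re_of_ofReal_le p2, h1]
  exact LinearMap.congr_fun h T

end HilbertSpace

theorem theorem4p4 {H : Type*} [NormedAddCommGroup H] [InnerProductSpace ℂ H] [CompleteSpace H]
    (p q s : ℝ) (hp : 0 < p) (hp' : p ≤ 1 / 2) (hq : 0 < q) (hq' : q ≤ 1 / 2)
    (hpq : p + q ≤ 1 / 2) (hs : 2 ≤ s) (hs' : s ≤ 1 / (p + q))
    (A B C : H →L[ℂ] H) (hB : IsStrictlyPositive B) (hC : IsStrictlyPositive C)
    (hBS : MemSchatten (1 / 2) (B ^ (-(p * s)))) (hCS : MemSchatten (1 / 2) (C ^ (-(q * s))))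
    (φ : (H →L[ℂ] H) →CP (H →L[ℂ] H)) (hφ : IsUCPTP φ)
    (hφBS : MemSchatten (1 / 2) (φ B ^ (-(p * s))))
    (hφCS : MemSchatten (1 / 2) (φ C ^ (-(q * s)))) :
    traceAbsPow (φ B ^ (-p) * φ A * φ C ^ (-q)) s ≤ traceAbsPow (B ^ (-p) * A * C ^ (-q)) s := by
  have := finiteDimensional_of_memSchatten (IsStrictlyPositive.rpow B _) hBS
  have hsp : s * (p + q) ≤ 1 := by rwa [le_div_iff₀ (by positivity)] at hs'
  have key := trace_abs_rpow_le (τ := traceFunctional H) traceFunctional_mul_comm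
    hφ.traceFunctional_map hφ.unital finite_real_spectrum hB hC A hp hq hs hsp
  have h1 (T : H →L[ℂ] H) :
      traceAbsPow T s = ENNReal.ofReal (traceFunctional H (CFC.abs T ^ s)).re :=
    opTrace_eq_traceFunctional CFC.rpow_nonneg
  rw [h1, h1]
  exact ENNReal.ofReal_le_ofReal key
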